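/- Let $k$ be an algebraically closed field, $Q=\mathbb P^1_k\times\mathbb P^1_k$, and $S=k[x_0,x_1,y_0,y_1]=\bigoplus_{a,b\ge 0}H^0\mathcal O_Q(a,b)$ its bihomogeneous coordinate ring. Order $\mathbb N^2$ by $(i,j)\le(i',j')$ iff $i\le i'$ and $j\le j'$ (and write $<$ for $\le$ and $\ne$). For a zero-dimensional closed subscheme $X\subset Q$ let $I_X=\bigcap_{P\in X}J_P\subset S$ be its saturated bihomogeneous ideal, $J_P$ being the saturated bihomogeneous ideal of the part of $X$ supported at $P$. The multiplicity of $X$ at $P$ is the length of $\mathcal O_{X,P}$. If it is $1$, a separator for $P\in X$ is a bihomogeneous form $f\in S$ with $f(P)\neq 0$ and $f\in\bigcap_{P'\in X\setminus\{P\}}J_{P'}$; a minimal separating degree for $P$ is the bidegree of a separator for $P$ such that no separator for $P$ has strictly smaller bidegree. Let $Y\subset Q$ be a zero-dimensional closed subscheme, with minimal bigraded free resolution $$0\to\bigoplus_{i=1}^t\mathcal O_Q(-a_{3i},-a'_{3i})\to\bigoplus_{i=1}^n\mathcal O_Q(-a_{2i},-a'_{2i})\to\bigoplus_{i=1}^m\mathcal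 O_Q(-a_{1i},-a'_{1i})\to\mathcal I_Y\to 0,$$ that is, the corresponding sequence of bigraded $S$-modules $0\to\bigoplus_i S(-a_{3i},-a'_{3i})\to\bigoplus_i S(-a_{2i},-a'_{2i})\to\bigoplus_i S(-a_{1i},-a'_{1i})\to I_Y\to0$ is a minimal free resolution of $I_Y$. Let $P$ be a point of $Y$ of multiplicity $1$, let $Z=Y\setminus\{P\}$, and suppose that there are $r,s\in\mathbb N$ such that 1. $(r,s)$ is the unique minimal separating degree for $P\in Y$; 2. $(r,s)\not<(a_{1i},a'_{1i})$ for every $i=1,\dots,m$; 3. $(r+1,s+1)\ne(a_{2i},a'_{2i})$ for every $i=1,\dots,n$. Then the minimal free resolution of $Z$ is, in the same sense, of the form $$0\to\bigoplus_{i=1}^t\mathcal O_Q(-a_{3i},-a'_{3i})\oplus\mathcal O_Q(-r-1,-s-1)\to\bigoplus_{i=1}^n\mathcal O_Q(-a_{2i},-a'_{2i})\oplus\mathcal O_Q(-r-1,-s)\oplus\mathcal O_Q(-r,-s-1)\to\bigoplus_{i=1}^m\mathcal O_Q(-a_{1i},-a'_{1i})\oplus\mathcal O_Q(-r,-s)\to\mathcal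 I_Z\to0.$$ -/

import Mathlib

namespace BiProj

noncomputable section

variable (k : Type*) [Field k]

/-- The bihomogeneous coordinate ring `S = k[x₀, x₁, y₀, y₁]` of `Q = ℙ¹ × ℙ¹`:
`Sum.inl i` indexes `xᵢ` and `Sum.inr j` indexes `yⱼ`. -/
abbrev CoordRing : Type _ := MvPolynomial (Fin 2 ⊕ Fin 2) k

/-- The bidegrees of the variables: `deg xᵢ = (1, 0)`, `deg yⱼ = (0, 1)`. -/
def bidegree : Fin 2 ⊕ Fin 2 → ℕ × ℕ :=
  Sum.elim (fun _ => (1, 0)) (fun _ => (0, 1))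

/-- `bigrading k (a, b)` is the space `S_{a,b} = H⁰(𝒪_Q(a, b))` of forms of bidegree `(a, b)`. -/
abbrev bigrading (d : ℕ × ℕ) : Submodule k (CoordRing k) :=
  MvPolynomial.weightedHomogeneousSubmodule k bidegree d

instance bigradedAlgebra : GradedAlgebra (bigrading k) :=
  MvPolynomial.weightedGradedAlgebra k bidegree

/-- The (closed) points of `ℙ¹ × ℙ¹` over the field `k`. -/
abbrev Point : Type _ :=
  Projectivization k (Fin 2 → k) × Projectivization k (Fin 2 → k)

variable {k}

/-- Bihomogeneous coordinates of a point. For a bihomogeneous form, whether it vanishes at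
these coordinates does not depend on the choice of representatives. -/
def Point.coords (P : Point k) : Fin 2 ⊕ Fin 2 → k :=
  Sum.elim P.1.rep P.2.rep

/-- The multiplicative set of the `f ∈ S` with `f(P) ≠ 0`. -/
def nonvanishing (P : Point k) : Submonoid (CoordRing k) where
  carrier := {f | MvPolynomial.eval P.coords f ≠ 0}
  one_mem' := by simp
  mul_mem' := by
    intro f g hf hg
    simpa using ⟨hf, hg⟩

/-- The local ring `𝒪_{Q,P}`: the fractions `f / g` of bihomogeneous forms of the same
bidegree with `g(P) ≠ 0`. -/
abbrev LocalRing (P : Point k) : Type _ :=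
  HomogeneousLocalization (bigrading k) (nonvanishing P)

/-- The fraction `f / g ∈ 𝒪_{Q,P}` of two forms of bidegree `d` with `g(P) ≠ 0`. -/
def germ (P : Point k) (d : ℕ × ℕ) (f g : CoordRing k) (hf : f ∈ bigrading k d)
    (hg : g ∈ bigrading k d) (hgP : g ∈ nonvanishing P) : LocalRing P :=
  HomogeneousLocalization.mk ⟨d, ⟨f, hf⟩, ⟨g, hg⟩, hgP⟩

variable (k)

/-- A closed subscheme of `ℙ¹ × ℙ¹` of dimension zero (or empty), given by the stalks of its ideal
sheaf at the closed points: ideals `ℐ_{X,P} ⊆ 𝒪_{Q,P}` of finite colength, all but finitely many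
of which are the unit ideal. Its local rings are `𝒪_{X,P} = 𝒪_{Q,P} / ℐ_{X,P}`. -/
structure ZeroDimScheme where
  /-- the stalk `ℐ_{X,P}` of the ideal sheaf -/
  stalk : ∀ P : Point k, Ideal (LocalRing P)
  finite_support : {P | stalk P ≠ ⊤}.Finite
  finite_length : ∀ P, IsFiniteLength (LocalRing P) (LocalRing P ⧸ stalk P)

variable {k}

namespace ZeroDimScheme

/-- The set of points of `X`. -/
def support (X : ZeroDimScheme k) : Set (Point k) := {P | X.stalk P ≠ ⊤}

/-- The multiplicity `m_X(P)`: the length of the local ring `𝒪_{X,P}`. -/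
def multiplicity (X : ZeroDimScheme k) (P : Point k) : ℕ∞ :=
  Module.length (LocalRing P) (LocalRing P ⧸ X.stalk P)

/-- The bihomogeneous ideal `J_P ⊆ S` of the part of `X` concentrated at `P`: it is generated by
the forms `f` whose germ at `P`, in any local trivialization, lies in `ℐ_{X,P}`. For `P` not
in `X` it is the unit ideal. -/
def component (X : ZeroDimScheme k) (P : Point k) : Ideal (CoordRing k) :=
  Ideal.span {f | ∃ (d : ℕ × ℕ) (hf : f ∈ bigrading k d),
    ∀ (g : CoordRing k) (hg : g ∈ bigrading k d) (hgP : g ∈ nonvanishing P),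
      germ P d f g hf hg hgP ∈ X.stalk P}

/-- The saturated bihomogeneous ideal `I_X = ⋂_P J_P` of `X`. -/
def ideal (X : ZeroDimScheme k) : Ideal (CoordRing k) := ⨅ P, X.component P

open Classical in
/-- `X ∖ {P}`, as a closed subscheme of `ℙ¹ × ℙ¹`. -/
def erase (X : ZeroDimScheme k) (P : Point k) : ZeroDimScheme k where
  stalk := Function.update X.stalk P ⊤
  finite_support := by
    refine X.finite_support.subset fun P' h => ?_
    by_cases hP : P' = P
    · subst hP
      simp at h
    · simpa [Function.update_of_ne hP] using h
  finite_length := by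
    intro P'
    by_cases hP : P' = P
    · subst hP
      rw [Function.update_self]
      have : Subsingleton (LocalRing P' ⧸ (⊤ : Ideal (LocalRing P'))) :=
        Ideal.Quotient.subsingleton_iff.2 rfl
      exact IsFiniteLength.of_subsingleton
    · rw [Function.update_of_ne hP]
      exact X.finite_length P'

/-- `f` is a separator of bidegree `d` for `P ∈ X`: a form of bidegree `d` that does not vanish
at `P` and lies in `J_{P'}` for every other point `P'` of `X`. -/
def IsSeparator (X : ZeroDimScheme k) (P : Point k) (d : ℕ × ℕ) (f : CoordRing k) : Prop :=
  f ∈ bigrading k d ∧ MvPolynomial.eval P.coords f ≠ 0 ∧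
    ∀ P' ∈ X.support, P' ≠ P → f ∈ X.component P'

/-- `d` is a minimal separating degree for `P ∈ X`: it is the bidegree of a separator, and no
separator has a smaller bidegree (for the componentwise partial order). -/
def IsMinimalSeparatingDegree (X : ZeroDimScheme k) (P : Point k) (d : ℕ × ℕ) : Prop :=
  (∃ f, X.IsSeparator P d f) ∧ ¬ ∃ e, e < d ∧ ∃ g, X.IsSeparator P e g

/-- `d` is the one and only minimal separating degree for `P ∈ X`. -/
def IsUniqueMinimalSeparatingDegree (X : ZeroDimScheme k) (P : Point k) (d : ℕ × ℕ) : Prop :=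
  X.IsMinimalSeparatingDegree P d ∧ ∀ e, X.IsMinimalSeparatingDegree P e → e = d

end ZeroDimScheme

/-- `v` is an element of bidegree `d` of the bigraded free module `⨁ᵢ S(-aᵢ)`: every monomial
`m` of its `i`-th coordinate satisfies `deg m + aᵢ = d`. -/
def IsShiftedHomogeneous {ι : Type*} (a : ι → ℕ × ℕ) (d : ℕ × ℕ) (v : ι → CoordRing k) : Prop :=
  ∀ i, ∀ m ∈ (v i).support, Finsupp.weight bidegree m + a i = d

/-- A minimal bigraded free resolution
`0 → ⨁ᵢ S(-a₃ᵢ) → ⨁ᵢ S(-a₂ᵢ) → ⨁ᵢ S(-a₁ᵢ) → I → 0`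
of an ideal `I` of `S`: an exact sequence of `S`-modules with maps of bidegree zero, in
which the differentials of the complex of free modules have no nonzero constant entries, that is,
have image in `(x₀, x₁, y₀, y₁)` times the free module. -/
structure MinimalFreeResolution (I : Ideal (CoordRing k)) {ι₁ ι₂ ι₃ : Type}
    (a₁ : ι₁ → ℕ × ℕ) (a₂ : ι₂ → ℕ × ℕ) (a₃ : ι₃ → ℕ × ℕ) where
  /-- the augmentation `⨁ᵢ S(-a₁ᵢ) → I ⊆ S` -/
  aug : (ι₁ → CoordRing k) →ₗ[CoordRing k] CoordRing k
  /-- the first syzygy map `⨁ᵢ S(-a₂ᵢ) → ⨁ᵢ S(-a₁ᵢ)` -/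
  syz₁ : (ι₂ → CoordRing k) →ₗ[CoordRing k] (ι₁ → CoordRing k)
  /-- the second syzygy map `⨁ᵢ S(-a₃ᵢ) → ⨁ᵢ S(-a₂ᵢ)` -/
  syz₂ : (ι₃ → CoordRing k) →ₗ[CoordRing k] (ι₂ → CoordRing k)
  aug_graded : ∀ d v, IsShiftedHomogeneous a₁ d v → aug v ∈ bigrading k d
  syz₁_graded : ∀ d v, IsShiftedHomogeneous a₂ d v → IsShiftedHomogeneous a₁ d (syz₁ v)
  syz₂_graded : ∀ d v, IsShiftedHomogeneous a₃ d v → IsShiftedHomogeneous a₂ d (syz₂ v)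
  range_aug : LinearMap.range aug = I
  exact₁ : Function.Exact syz₁ aug
  exact₂ : Function.Exact syz₂ syz₁
  syz₂_injective : Function.Injective syz₂
  syz₁_minimal : ∀ v i, MvPolynomial.constantCoeff (syz₁ v i) = 0
  syz₂_minimal : ∀ v i, MvPolynomial.constantCoeff (syz₂ v i) = 0

end

end BiProj

/-! Let `f` be a separator of bidegree (r, s), and let l, l' be the linear forms of bidegrees (1,
0), (0, 1) vanishing at P. Since P is reduced, membership of a form in J_P means vanishing at P.

A form g in I_Z with g(P) ≠ 0 is a separator, so uniqueness of the minimal degree puts its bidegree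
above (r, s). Some multiple of `f` then has the same bidegree and the same value at P, and the
difference lies in I_Y. Hence I_Z = I_Y + (f) (`ideal_erase_eq_sup`). Moreover c f ∈ I_Y exactly
when c ∈ (l, l'), the ideal of P. This gives 0 → I_Y → I_Z → (S/(l, l'))(-r, -s) → 0.

The right-hand term is resolved by the Koszul complex of the regular sequence l, l', and the
horseshoe construction (`sup_span_singleton`) combines it with the resolution of I_Y. The only new
entries that could be nonzero constants are those of the gluing maps. Conditions 2 and 3 exclude
these by degree. -/

namespace BiProj

noncomputable section

variable {k : Type*} [Field k]

/-! ### Graded pieces of shifted free modules -/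

/-- A polynomial is a form of degree `d` in the shifted module `S(-a)` when all its monomials `m`
satisfy `deg m + a = d`. -/
def IsShiftedForm (a d : ℕ × ℕ) (p : CoordRing k) : Prop :=
  ∀ m ∈ p.support, Finsupp.weight bidegree m + a = d

theorem isShiftedForm_iff_mem_bigrading {d e : ℕ × ℕ} {p : CoordRing k} (a : ℕ × ℕ)
    (h : d + a = e) : IsShiftedForm a e p ↔ p ∈ bigrading k d := by
  subst h
  simp only [IsShiftedForm, MvPolynomial.mem_support_iff, add_left_inj,
    MvPolynomial.mem_weightedHomogeneousSubmodule, MvPolynomial.IsWeightedHomogeneous]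

theorem IsShiftedForm.mul {a b d : ℕ × ℕ} {p q : CoordRing k} (hp : IsShiftedForm a d p)
    (hq : IsShiftedForm b a q) : IsShiftedForm b d (p * q) := by
  classical
  intro m hm
  obtain ⟨m₁, h₁, m₂, h₂, rfl⟩ := Finset.mem_add.1 (MvPolynomial.support_mul p q hm)
  rw [map_add, add_assoc, hq m₂ h₂, hp m₁ h₁]

theorem IsShiftedForm.add {a d : ℕ × ℕ} {p q : CoordRing k} (hp : IsShiftedForm a d p)
    (hq : IsShiftedForm a d q) : IsShiftedForm a d (p + q) := by
  classical
  intro m hm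
  rcases Finset.mem_union.1 (MvPolynomial.support_add hm) with h | h
  exacts [hp m h, hq m h]

theorem IsShiftedForm.neg {a d : ℕ × ℕ} {p : CoordRing k} (hp : IsShiftedForm a d p) :
    IsShiftedForm a d (-p) := by
  intro m hm
  exact hp m (by simpa using hm)

theorem IsShiftedForm.sub {a d : ℕ × ℕ} {p q : CoordRing k} (hp : IsShiftedForm a d p)
    (hq : IsShiftedForm a d q) : IsShiftedForm a d (p - q) := by
  rw [sub_eq_add_neg]
  exact hp.add hq.neg

/-- A nonzero constant term is a monomial of weight 0 and forces the two degrees to agree. This is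
how minimality is read off from bidegrees. -/
theorem IsShiftedForm.constantCoeff_eq_zero {a d : ℕ × ℕ} {p : CoordRing k}
    (hp : IsShiftedForm a d p) (h : a ≠ d) : MvPolynomial.constantCoeff p = 0 := by
  by_contra hne
  exact h (by simpa using hp 0 (by simpa [MvPolynomial.constantCoeff_eq] using hne))

/-- The part of degree `d` of an element of `S(-a)`. -/
def shiftedPart (a d : ℕ × ℕ) : CoordRing k →+ CoordRing k where
  toFun p := .ofCoeff (Finsupp.filter (fun m => Finsupp.weight bidegree m + a = d)
    (AddMonoidAlgebra.coeff p))
  map_zero' := congrArg _ (Finsupp.filter_zero _)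
  map_add' _ _ := congrArg _ Finsupp.filter_add

theorem shiftedPart_isShiftedForm (a d : ℕ × ℕ) (p : CoordRing k) :
    IsShiftedForm a d (shiftedPart a d p) := by
  classical
  intro m hm
  by_contra h
  exact (MvPolynomial.mem_support_iff.1 hm)
    (Finsupp.filter_apply_neg (fun m => Finsupp.weight bidegree m + a = d) _ h)

theorem shiftedPart_of_isShiftedForm {a d : ℕ × ℕ} {p : CoordRing k}
    (hp : IsShiftedForm a d p) : shiftedPart a d p = p :=
  congrArg AddMonoidAlgebra.ofCoeff <| (Finsupp.filter_eq_self_iff _ _).2 fun m hm =>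
    hp m (MvPolynomial.mem_support_iff.2 hm)

theorem shiftedPart_of_isShiftedForm_of_ne {a d e : ℕ × ℕ} {p : CoordRing k}
    (hp : IsShiftedForm a e p) (h : e ≠ d) : shiftedPart a d p = 0 := by
  classical
  refine congrArg AddMonoidAlgebra.ofCoeff <| (Finsupp.filter_eq_zero_iff _ _).2 fun m hm => ?_
  by_contra hne
  exact h ((hp m (MvPolynomial.mem_support_iff.2 hne)).symm.trans hm)

theorem isShiftedForm_monomial (a : ℕ × ℕ) (m : Fin 2 ⊕ Fin 2 →₀ ℕ) (c : k) :
    IsShiftedForm a (Finsupp.weight bidegree m + a) (MvPolynomial.monomial m c) := by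
  intro m' hm'
  rw [Finset.mem_singleton.1 (MvPolynomial.support_monomial_subset hm')]

/-- The part of degree `d` of an element of `⨁ᵢ S(-aᵢ)`. -/
def modulePart {ι : Type*} (a : ι → ℕ × ℕ) (d : ℕ × ℕ) :
    (ι → CoordRing k) →+ (ι → CoordRing k) where
  toFun v i := shiftedPart (a i) d (v i)
  map_zero' := by ext1 i; simp
  map_add' v w := by ext1 i; simp

theorem modulePart_isShiftedHomogeneous {ι : Type*} (a : ι → ℕ × ℕ) (d : ℕ × ℕ)
    (v : ι → CoordRing k) : IsShiftedHomogeneous a d (modulePart a d v) :=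
  fun _ => shiftedPart_isShiftedForm _ _ _

theorem modulePart_of_isShiftedHomogeneous {ι : Type*} {a : ι → ℕ × ℕ} {d : ℕ × ℕ}
    {v : ι → CoordRing k} (hv : IsShiftedHomogeneous a d v) : modulePart a d v = v :=
  funext fun i => shiftedPart_of_isShiftedForm (hv i)

theorem modulePart_of_isShiftedHomogeneous_of_ne {ι : Type*} {a : ι → ℕ × ℕ} {d e : ℕ × ℕ}
    {v : ι → CoordRing k} (hv : IsShiftedHomogeneous a e v) (h : e ≠ d) :
    modulePart a d v = 0 :=
  funext fun i => shiftedPart_of_isShiftedForm_of_ne (hv i) h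

/-- A map of degree zero between graded free modules commutes with taking graded parts. -/
theorem map_modulePart {ι κ : Type*} [Finite ι] {a : ι → ℕ × ℕ} {b : κ → ℕ × ℕ}
    (φ : (ι → CoordRing k) →ₗ[CoordRing k] (κ → CoordRing k))
    (hφ : ∀ d v, IsShiftedHomogeneous a d v → IsShiftedHomogeneous b d (φ v))
    (d : ℕ × ℕ) (v : ι → CoordRing k) : φ (modulePart a d v) = modulePart b d (φ v) := by
  classical
  -- Taking graded parts is additive but not S-linear, so both sides are compared as additive maps.
  -- It suffices to test a single monomial in one coordinate, which is homogeneous.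
  have key : φ.toAddMonoidHom.comp (modulePart a d) = (modulePart b d).comp φ.toAddMonoidHom := by
    refine AddMonoidHom.functions_ext _ _ _ fun i p => ?_
    induction p using MvPolynomial.induction_on' with
    | monomial m c =>
      have hv : IsShiftedHomogeneous a (Finsupp.weight bidegree m + a i)
          (Pi.single i (MvPolynomial.monomial m c)) := by
        intro j
        by_cases hj : j = i
        · subst hj
          rw [Pi.single_eq_same]
          exact isShiftedForm_monomial _ _ _
        · simp [Pi.single_eq_of_ne hj]
      change φ (modulePart a d _) = modulePart b d (φ _)
      by_cases h : Finsupp.weight bidegree m + a i = d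
      · rw [h] at hv
        rw [modulePart_of_isShiftedHomogeneous hv,
          modulePart_of_isShiftedHomogeneous (hφ _ _ hv)]
      · rw [modulePart_of_isShiftedHomogeneous_of_ne hv h,
          modulePart_of_isShiftedHomogeneous_of_ne (hφ _ _ hv) h, map_zero]
    | add p q hp hq => rw [Pi.single_add, map_add, map_add, hp, hq]
  exact DFunLike.congr_fun key v

/-- The degree d part of any preimage is again a preimage. -/
theorem exists_isShiftedHomogeneous_lift {ι κ : Type*} [Finite ι] {a : ι → ℕ × ℕ}
    {b : κ → ℕ × ℕ} (φ : (ι → CoordRing k) →ₗ[CoordRing k] (κ → CoordRing k))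
    (hφ : ∀ d v, IsShiftedHomogeneous a d v → IsShiftedHomogeneous b d (φ v))
    {d : ℕ × ℕ} {w : κ → CoordRing k} (hw : IsShiftedHomogeneous b d w)
    (hmem : w ∈ LinearMap.range φ) : ∃ v, IsShiftedHomogeneous a d v ∧ φ v = w := by
  obtain ⟨v, rfl⟩ := hmem
  exact ⟨modulePart a d v, modulePart_isShiftedHomogeneous a d v, by
    rw [map_modulePart φ hφ, modulePart_of_isShiftedHomogeneous hw]⟩

/-! ### Resolutions and the horseshoe construction -/

namespace MinimalFreeResolution

variable {I : Ideal (CoordRing k)} {ι₁ ι₂ ι₃ : Type}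
  {a₁ : ι₁ → ℕ × ℕ} {a₂ : ι₂ → ℕ × ℕ} {a₃ : ι₃ → ℕ × ℕ}

theorem mem_iff_exists_aug_eq (res : MinimalFreeResolution I a₁ a₂ a₃) (g : CoordRing k) :
    g ∈ I ↔ ∃ v, res.aug v = g := by
  rw [← LinearMap.mem_range]
  exact (SetLike.ext_iff.1 res.range_aug g).symm

theorem exists_aug_eq [Finite ι₁] (res : MinimalFreeResolution I a₁ a₂ a₃) {d : ℕ × ℕ}
    {g : CoordRing k} (hg : g ∈ bigrading k d) (hgI : g ∈ I) :
    ∃ u, IsShiftedHomogeneous a₁ d u ∧ res.aug u = g := by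
  have hiff := fun d (p : CoordRing k) =>
    isShiftedForm_iff_mem_bigrading (p := p) (0 : ℕ × ℕ) (add_zero d)
  obtain ⟨u₀, rfl⟩ := (res.mem_iff_exists_aug_eq g).1 hgI
  -- S is treated as the free module on one generator of degree 0, so that the lifting result for
  -- free modules applies.
  obtain ⟨u, hu, hug⟩ := exists_isShiftedHomogeneous_lift (b := fun _ : Unit => 0)
    (LinearMap.pi fun _ => res.aug) (fun d v hv _ => (hiff d _).2 (res.aug_graded d v hv))
    (fun _ => (hiff d _).2 hg) ⟨u₀, rfl⟩
  exact ⟨u, hu, congrFun hug ()⟩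

/-- The horseshoe construction: from a minimal resolution of `I`, and a form `f` with
`I : f = (l, l')` for a regular sequence `l`, `l'` of forms of bidegrees `(1, 0)` and `(0, 1)`,
a resolution of `I + (f)`. It is minimal when no generator of `I` has bidegree `(r + 1, s)` or
`(r, s + 1)` and no first syzygy has bidegree `(r + 1, s + 1)`. -/
theorem sup_span_singleton [Finite ι₁] [Finite ι₂] (res : MinimalFreeResolution I a₁ a₂ a₃)
    {r s : ℕ} {f l l' : CoordRing k}
    (hf : f ∈ bigrading k (r, s)) (hl : l ∈ bigrading k (1, 0)) (hl' : l' ∈ bigrading k (0, 1))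
    (hlf : l * f ∈ I) (hlf' : l' * f ∈ I)
    (hcolon : ∀ c, c * f ∈ I → ∃ b b', c = b * l + b' * l')
    (hkoszul : ∀ b b', b * l + b' * l' = 0 → ∃ e, b = e * l' ∧ b' = -(e * l))
    (hne : l' ≠ 0)
    (hgen : ∀ i, a₁ i ≠ (r + 1, s)) (hgen' : ∀ i, a₁ i ≠ (r, s + 1))
    (hsyz : ∀ i, a₂ i ≠ (r + 1, s + 1)) :
    Nonempty (MinimalFreeResolution (I ⊔ Ideal.span {f})
      (Sum.elim a₁ ![(r, s)])
      (Sum.elim a₂ ![(r + 1, s), (r, s + 1)])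
      (Sum.elim a₃ ![(r + 1, s + 1)])) := by
  have hmul {p q : CoordRing k} {d e : ℕ × ℕ} (d' : ℕ × ℕ) (h : d + e = d')
      (hp : p ∈ bigrading k d) (hq : q ∈ bigrading k e) : p * q ∈ bigrading k d' :=
    h ▸ SetLike.mul_mem_graded hp hq
  -- `u` and `u'` express l f and l' f in the generators of I. They glue the Koszul generators to
  -- the old resolution.
  obtain ⟨u, hu, huf⟩ :=
    res.exists_aug_eq (hmul (r + 1, s) (by ext <;> simp [add_comm]) hl hf) hlf
  obtain ⟨u', hu', huf'⟩ :=
    res.exists_aug_eq (hmul (r, s + 1) (by ext <;> simp [add_comm]) hl' hf) hlf'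
  have hlsh (d a : ℕ × ℕ) (h : (1, 0) + a = d) : IsShiftedForm a d l :=
    (isShiftedForm_iff_mem_bigrading a h).2 hl
  have hlsh' (d a : ℕ × ℕ) (h : (0, 1) + a = d) : IsShiftedForm a d l' :=
    (isShiftedForm_iff_mem_bigrading a h).2 hl'
  -- The identity l'(l f) = l(l' f) makes l' u - l u' a syzygy. Its lift `w` glues in the Koszul
  -- relation.
  obtain ⟨w, hw, hwu⟩ := exists_isShiftedHomogeneous_lift res.syz₁ res.syz₁_graded
    (d := (r + 1, s + 1)) (w := l' • u - l • u')
    (fun i => ((hlsh' _ (r + 1, s) (by ext <;> simp [add_comm])).mul (hu i)).sub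
      ((hlsh _ (r, s + 1) (by ext <;> simp [add_comm])).mul (hu' i)))
    ((res.exact₁ _).1 (by
      rw [map_sub, map_smul, map_smul, huf, huf', smul_eq_mul, smul_eq_mul]
      ring))
  have hcl : MvPolynomial.constantCoeff l = 0 :=
    (hlsh _ 0 rfl).constantCoeff_eq_zero (by decide)
  have hcl' : MvPolynomial.constantCoeff l' = 0 :=
    (hlsh' _ 0 rfl).constantCoeff_eq_zero (by decide)
  have hcu i : MvPolynomial.constantCoeff (u i) = 0 :=
    IsShiftedForm.constantCoeff_eq_zero (hu i) (hgen i)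
  have hcu' i : MvPolynomial.constantCoeff (u' i) = 0 :=
    IsShiftedForm.constantCoeff_eq_zero (hu' i) (hgen' i)
  have hcw i : MvPolynomial.constantCoeff (w i) = 0 :=
    IsShiftedForm.constantCoeff_eq_zero (hw i) (hsyz i)
  -- In block form the maps are (aug, f), then [syz₁, -u, -u'; 0, l, l'], then [syz₂, w; 0, (l',
  -- -l)ᵗ]. The signs make consecutive products vanish.
  let aug : (ι₁ ⊕ Fin 1 → CoordRing k) →ₗ[CoordRing k] CoordRing k :=
    { toFun := fun v => res.aug (fun i => v (.inl i)) + v (.inr 0) * f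
      map_add' := fun v v' => by
        have : (fun i => (v + v') (.inl i)) =
          (fun i => v (Sum.inl i)) + fun i => v' (Sum.inl i) := rfl
        rw [this, map_add, Pi.add_apply]; ring
      map_smul' := fun c v => by
        have : (fun i => (c • v) (.inl i)) = c • (fun i => v (Sum.inl i)) := rfl
        rw [this, map_smul, Pi.smul_apply]; simp only [smul_eq_mul, RingHom.id_apply]; ring }
  let syz₁ : (ι₂ ⊕ Fin 2 → CoordRing k) →ₗ[CoordRing k] (ι₁ ⊕ Fin 1 → CoordRing k) :=
    { toFun := fun v => Sum.elim
        (res.syz₁ (fun i => v (.inl i)) - (v (.inr 0) • u + v (.inr 1) • u'))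
        (fun _ => v (.inr 0) * l + v (.inr 1) * l')
      map_add' := fun v v' => by
        have : (fun i => (v + v') (.inl i)) =
          (fun i => v (Sum.inl i)) + fun i => v' (Sum.inl i) := rfl
        rw [this, map_add]
        ext1 (i | i) <;> simp <;> ring
      map_smul' := fun c v => by
        have : (fun i => (c • v) (.inl i)) = c • (fun i => v (Sum.inl i)) := rfl
        rw [this, map_smul]
        ext1 (i | i) <;> simp <;> ring }
  let syz₂ : (ι₃ ⊕ Fin 1 → CoordRing k) →ₗ[CoordRing k] (ι₂ ⊕ Fin 2 → CoordRing k) :=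
    { toFun := fun v => Sum.elim
        (res.syz₂ (fun i => v (.inl i)) + v (.inr 0) • w)
        ![v (.inr 0) * l', -(v (.inr 0) * l)]
      map_add' := fun v v' => by
        have : (fun i => (v + v') (.inl i)) =
          (fun i => v (Sum.inl i)) + fun i => v' (Sum.inl i) := rfl
        rw [this, map_add]
        ext1 (i | i)
        · simp; ring
        · fin_cases i <;> simp <;> ring
      map_smul' := fun c v => by
        have : (fun i => (c • v) (.inl i)) = c • (fun i => v (Sum.inl i)) := rfl
        rw [this, map_smul]
        ext1 (i | i)
        · simp; ring
        · fin_cases i <;> simp <;> ring }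
  have haug v : aug v = res.aug (fun i => v (.inl i)) + v (.inr 0) * f := rfl
  have hsyz₁l v i : syz₁ v (.inl i) =
    res.syz₁ (fun i => v (.inl i)) i - (v (.inr 0) * u i + v (.inr 1) * u' i) := rfl
  have hsyz₁r v i : syz₁ v (.inr i) = v (.inr 0) * l + v (.inr 1) * l' := rfl
  have hsyz₂l v i : syz₂ v (.inl i) =
    res.syz₂ (fun i => v (.inl i)) i + v (.inr 0) * w i := rfl
  have hsyz₂0 v : syz₂ v (.inr 0) = v (.inr 0) * l' := rfl
  have hsyz₂1 v : syz₂ v (.inr 1) = -(v (.inr 0) * l) := rfl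
  refine ⟨{
    aug := aug
    syz₁ := syz₁
    syz₂ := syz₂
    aug_graded := ?_
    syz₁_graded := ?_
    syz₂_graded := ?_
    range_aug := ?_
    exact₁ := ?_
    exact₂ := ?_
    syz₂_injective := ?_
    syz₁_minimal := ?_
    syz₂_minimal := ?_ }⟩
  · intro d v hv
    have h0 : IsShiftedForm (r, s) d (v (.inr 0)) := hv (.inr 0)
    rw [haug]
    refine add_mem (res.aug_graded d _ fun i => hv (.inl i)) ?_
    rw [← isShiftedForm_iff_mem_bigrading 0 (add_zero d)]
    exact h0.mul ((isShiftedForm_iff_mem_bigrading 0 (add_zero _)).2 hf)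
  · intro d v hv
    have h0 : IsShiftedForm (r + 1, s) d (v (.inr 0)) := hv (.inr 0)
    have h1 : IsShiftedForm (r, s + 1) d (v (.inr 1)) := hv (.inr 1)
    rintro (i | i)
    · rw [hsyz₁l]
      exact IsShiftedForm.sub (res.syz₁_graded d _ (fun i => hv (.inl i)) i)
        ((h0.mul (hu i)).add (h1.mul (hu' i)))
    · rw [hsyz₁r, Subsingleton.elim i 0]
      exact (h0.mul (hlsh _ _ (by ext <;> simp [add_comm]))).add
        (h1.mul (hlsh' _ _ (by ext <;> simp [add_comm])))
  · intro d v hv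
    have h0 : IsShiftedForm (r + 1, s + 1) d (v (.inr 0)) := hv (.inr 0)
    rintro (i | i)
    · rw [hsyz₂l]
      exact IsShiftedForm.add (res.syz₂_graded d _ (fun i => hv (.inl i)) i) (h0.mul (hw i))
    · fin_cases i
      · exact h0.mul (hlsh' _ (r + 1, s) (by ext <;> simp [add_comm]))
      · exact (h0.mul (hlsh _ (r, s + 1) (by ext <;> simp [add_comm]))).neg
  · ext g
    rw [Submodule.mem_sup]
    constructor
    · rintro ⟨v, rfl⟩
      exact ⟨_, (res.mem_iff_exists_aug_eq _).2 ⟨_, rfl⟩, _,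
        Ideal.mul_mem_left _ (v (.inr 0)) (Ideal.mem_span_singleton_self f), rfl⟩
    · rintro ⟨y, hy, z, hz, rfl⟩
      obtain ⟨c, rfl⟩ := Ideal.mem_span_singleton'.1 hz
      obtain ⟨x, rfl⟩ := (res.mem_iff_exists_aug_eq y).1 hy
      exact ⟨Sum.elim x fun _ => c, rfl⟩
  · intro v
    constructor
    · intro hv
      rw [haug] at hv
      -- In a relation, the coefficient of f lies in I : f, hence equals b l + b' l'. Replacing l f
      -- and l' f by their expansions leaves a relation among the old generators.
      obtain ⟨b, b', hb⟩ := hcolon (v (.inr 0)) (by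
        rw [eq_neg_of_add_eq_zero_right hv]
        exact neg_mem ((res.mem_iff_exists_aug_eq _).2 ⟨_, rfl⟩))
      obtain ⟨x, hx⟩ := (res.exact₁ ((fun i => v (.inl i)) + (b • u + b' • u'))).1 (by
        rw [map_add, map_add, map_smul, map_smul, huf, huf', ← hv, hb]
        simp only [smul_eq_mul]
        ring)
      refine ⟨Sum.elim x ![b, b'], ?_⟩
      ext1 (i | i)
      · rw [hsyz₁l]
        change res.syz₁ x i - (b * u i + b' * u' i) = _
        rw [hx]
        simp
      · rw [hsyz₁r, Subsingleton.elim i 0, hb]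
        rfl
    · rintro ⟨x, rfl⟩
      rw [haug, hsyz₁r]
      change res.aug (res.syz₁ (fun i => x (.inl i)) - (x (.inr 0) • u + x (.inr 1) • u')) + _ = 0
      rw [map_sub, res.exact₁.apply_apply_eq_zero, map_add, map_smul, map_smul, huf, huf']
      simp only [smul_eq_mul]
      ring
  · intro v
    constructor
    · intro hv
      have h0 := congrFun hv (.inr 0)
      rw [hsyz₁r] at h0
      -- The new coordinates are e times the Koszul relation. Subtracting e w from the old ones
      -- leaves an element of the kernel of the old `syz₁`.
      obtain ⟨e, hb, hb'⟩ := hkoszul _ _ h0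
      obtain ⟨x, hx⟩ := (res.exact₂ ((fun i => v (.inl i)) - e • w)).1 (by
        ext1 i
        have hi := congrFun hv (.inl i)
        rw [hsyz₁l, hb, hb'] at hi
        rw [map_sub, map_smul, hwu]
        simp only [Pi.sub_apply, Pi.smul_apply, smul_eq_mul, Pi.zero_apply] at hi ⊢
        linear_combination hi)
      refine ⟨Sum.elim x fun _ => e, ?_⟩
      ext1 (i | i)
      · rw [hsyz₂l]
        change res.syz₂ x i + e * w i = _
        rw [hx]
        simp
      · fin_cases i
        · exact hb.symm
        · exact hb'.symm
    · rintro ⟨x, rfl⟩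
      ext1 (i | i)
      · rw [hsyz₁l, hsyz₂0, hsyz₂1]
        change res.syz₁ (res.syz₂ (fun i => x (.inl i)) + x (.inr 0) • w) i - _ = 0
        rw [map_add, res.exact₂.apply_apply_eq_zero, map_smul, hwu]
        simp only [Pi.sub_apply, Pi.add_apply, Pi.smul_apply, smul_eq_mul, Pi.zero_apply]
        ring
      · rw [hsyz₁r, hsyz₂0, hsyz₂1, Pi.zero_apply]
        ring
  · rw [injective_iff_map_eq_zero]
    intro v hv
    have h0 : v (.inr 0) = 0 :=
      (mul_eq_zero.1 ((hsyz₂0 v).symm.trans (congrFun hv (.inr 0)))).resolve_right hne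
    have h1 : (fun i => v (.inl i)) = 0 := by
      refine (injective_iff_map_eq_zero _).1 res.syz₂_injective _ (funext fun i => ?_)
      have hi := congrFun hv (.inl i)
      rwa [hsyz₂l, h0, zero_mul, add_zero] at hi
    ext1 (i | i)
    · exact congrFun h1 i
    · rw [Subsingleton.elim i 0, h0, Pi.zero_apply]
  · rintro v (i | i)
    · simp [hsyz₁l, res.syz₁_minimal, hcu, hcu']
    · simp [hsyz₁r, hcl, hcl']
  · rintro v (i | i)
    · simp [hsyz₂l, res.syz₂_minimal, hcw]
    · fin_cases i
      · change MvPolynomial.constantCoeff (v (.inr 0) * l') = 0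
        simp [hcl']
      · change MvPolynomial.constantCoeff (-(v (.inr 0) * l)) = 0
        simp [hcl]

end MinimalFreeResolution

/-! ### The linear forms and the ideal of a point -/

/-- A substitution that fixes the variables modulo I induces the identity on the quotient by I. -/
theorem aeval_sub_self_mem {σ R : Type*} [CommRing R] (I : Ideal (MvPolynomial σ R))
    (g : σ → MvPolynomial σ R) (hg : ∀ i, g i - MvPolynomial.X i ∈ I) (c : MvPolynomial σ R) :
    MvPolynomial.aeval g c - c ∈ I := by
  rw [← Ideal.Quotient.eq, ← Ideal.Quotient.mkₐ_eq_mk R]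
  have : (Ideal.Quotient.mkₐ R I).comp (MvPolynomial.aeval g) = Ideal.Quotient.mkₐ R I :=
    MvPolynomial.algHom_ext fun i => by
      simpa [Ideal.Quotient.mkₐ_eq_mk] using Ideal.Quotient.eq.2 (hg i)
  exact DFunLike.congr_fun this c

theorem weight_bidegree (m : Fin 2 ⊕ Fin 2 →₀ ℕ) :
    Finsupp.weight bidegree m = (∑ i, m (.inl i), ∑ j, m (.inr j)) := by
  rw [Finsupp.weight_apply, Finsupp.sum_fintype _ _ (by simp), Fintype.sum_sum_type]
  ext <;> simp [bidegree]

/-- A form of bidegree `(a, b)` is bihomogeneous under substitution. -/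
theorem aeval_mul_of_mem_bigrading {a b : ℕ} {c : CoordRing k} (hc : c ∈ bigrading k (a, b))
    (z : Fin 2 ⊕ Fin 2 → k) (s t : CoordRing k) :
    MvPolynomial.aeval (fun v => MvPolynomial.C (z v) * Sum.elim (fun _ => s) (fun _ => t) v) c =
      MvPolynomial.C (MvPolynomial.eval z c) * (s ^ a * t ^ b) := by
  rw [MvPolynomial.aeval_def, MvPolynomial.eval₂_eq', MvPolynomial.eval_eq', map_sum,
    Finset.sum_mul]
  refine Finset.sum_congr rfl fun m hm => ?_
  have hw := (weight_bidegree m).symm.trans (hc (MvPolynomial.mem_support_iff.1 hm))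
  rw [Prod.mk.injEq] at hw
  rw [← hw.1, ← hw.2, ← Finset.prod_pow_eq_pow_sum, ← Finset.prod_pow_eq_pow_sum, map_mul,
    map_prod, mul_assoc]
  simp only [mul_pow, Finset.prod_mul_distrib, map_pow, MvPolynomial.algebraMap_eq,
    Fintype.prod_sum_type, Sum.elim_inl, Sum.elim_inr]

/-- The linear form in the two variables `e 0`, `e 1` that vanishes at `z`. -/
def pairForm (e : Fin 2 → Fin 2 ⊕ Fin 2) (z : Fin 2 ⊕ Fin 2 → k) : CoordRing k :=
  MvPolynomial.C (z (e 1)) * MvPolynomial.X (e 0) - MvPolynomial.C (z (e 0)) * MvPolynomial.X (e 1)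

theorem pairForm_mem_bigrading (e : Fin 2 → Fin 2 ⊕ Fin 2) (z : Fin 2 ⊕ Fin 2 → k) (d : ℕ × ℕ)
    (h : ∀ j, bidegree (e j) = d) : pairForm e z ∈ bigrading k d := by
  refine sub_mem ?_ ?_ <;> rw [← MvPolynomial.smul_eq_C_mul] <;> refine Submodule.smul_mem _ _ ?_
  exacts [h 0 ▸ MvPolynomial.isWeightedHomogeneous_X k bidegree (e 0),
    h 1 ▸ MvPolynomial.isWeightedHomogeneous_X k bidegree (e 1)]

theorem eval_pairForm (e : Fin 2 → Fin 2 ⊕ Fin 2) (z : Fin 2 ⊕ Fin 2 → k) :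
    MvPolynomial.eval z (pairForm e z) = 0 := by
  simp [pairForm, mul_comm]

theorem pairForm_ne_zero {e : Fin 2 → Fin 2 ⊕ Fin 2} (he : Function.Injective e)
    {z : Fin 2 ⊕ Fin 2 → k} {i : Fin 2} (hi : z (e i) ≠ 0) : pairForm e z ≠ 0 := by
  classical
  intro h
  have h0 : z (e 1) = 0 := by
    simpa [pairForm, he.eq_iff] using congrArg (MvPolynomial.eval (Pi.single (e 0) 1)) h
  have h1 : z (e 0) = 0 := by
    simpa [pairForm, he.eq_iff] using congrArg (MvPolynomial.eval (Pi.single (e 1) 1)) h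
  fin_cases i
  exacts [hi h1, hi h0]

/-- Modulo the linear form, the two variables are proportional to the coordinates of z, so either
one is determined by a variable whose coordinate is nonzero. -/
theorem C_mul_sub_X_mem_span_pairForm (e : Fin 2 → Fin 2 ⊕ Fin 2) (z : Fin 2 ⊕ Fin 2 → k)
    {i : Fin 2} (hi : z (e i) ≠ 0) (j : Fin 2) :
    MvPolynomial.C (z (e j)) * (MvPolynomial.C (z (e i))⁻¹ * MvPolynomial.X (e i)) -
      MvPolynomial.X (e j) ∈ Ideal.span {pairForm e z} := by
  have hC : (MvPolynomial.C (z (e i)) : CoordRing k) * MvPolynomial.C (z (e i))⁻¹ = 1 := by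
    rw [← map_mul, mul_inv_cancel₀ hi, map_one]
  rw [Ideal.mem_span_singleton']
  by_cases hij : j = i
  · subst hij
    exact ⟨0, by rw [← mul_assoc, hC]; ring⟩
  · fin_cases i <;> fin_cases j
    · exact absurd rfl hij
    · refine ⟨MvPolynomial.C (z (e 0))⁻¹, ?_⟩
      simp only [pairForm, Fin.mk_one, Fin.zero_eta] at hC ⊢
      linear_combination (-MvPolynomial.X (e 1)) * hC
    · refine ⟨-MvPolynomial.C (z (e 1))⁻¹, ?_⟩
      simp only [pairForm, Fin.mk_one, Fin.zero_eta] at hC ⊢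
      linear_combination (-MvPolynomial.X (e 0)) * hC
    · exact absurd rfl hij

namespace Point

theorem exists_coords_inl_ne_zero (P : Point k) : ∃ i, P.coords (.inl i) ≠ 0 :=
  Function.ne_iff.1 P.1.rep_nonzero

theorem exists_coords_inr_ne_zero (P : Point k) : ∃ j, P.coords (.inr j) ≠ 0 :=
  Function.ne_iff.1 P.2.rep_nonzero

/-- The form of bidegree `(1, 0)` that vanishes at `P`. -/
def xForm (P : Point k) : CoordRing k := pairForm Sum.inl P.coords

/-- The form of bidegree `(0, 1)` that vanishes at `P`. -/
def yForm (P : Point k) : CoordRing k := pairForm Sum.inr P.coords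

theorem xForm_mem_bigrading (P : Point k) : P.xForm ∈ bigrading k (1, 0) :=
  pairForm_mem_bigrading _ _ _ fun _ => rfl

theorem yForm_mem_bigrading (P : Point k) : P.yForm ∈ bigrading k (0, 1) :=
  pairForm_mem_bigrading _ _ _ fun _ => rfl

theorem eval_xForm (P : Point k) : MvPolynomial.eval P.coords P.xForm = 0 := eval_pairForm _ _

theorem eval_yForm (P : Point k) : MvPolynomial.eval P.coords P.yForm = 0 := eval_pairForm _ _

theorem xForm_ne_zero (P : Point k) : P.xForm ≠ 0 :=
  pairForm_ne_zero Sum.inl_injective P.exists_coords_inl_ne_zero.choose_spec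

theorem yForm_ne_zero (P : Point k) : P.yForm ≠ 0 :=
  pairForm_ne_zero Sum.inr_injective P.exists_coords_inr_ne_zero.choose_spec

/-- A form vanishing at `P` lies in the ideal generated by the linear forms of `P`. -/
theorem mem_span_of_eval_eq_zero (P : Point k) {d : ℕ × ℕ} {c : CoordRing k}
    (hc : c ∈ bigrading k d) (h : MvPolynomial.eval P.coords c = 0) :
    c ∈ Ideal.span {P.xForm, P.yForm} := by
  obtain ⟨i, hi⟩ := P.exists_coords_inl_ne_zero
  obtain ⟨j, hj⟩ := P.exists_coords_inr_ne_zero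
  -- Modulo the two linear forms, every variable becomes its coordinate at P times a fixed multiple
  -- of one x or one y. Bihomogeneity turns `c` into c(P) times a monomial, which is 0.
  have key := aeval_sub_self_mem (Ideal.span {P.xForm, P.yForm})
    (fun v => MvPolynomial.C (P.coords v) * Sum.elim
      (fun _ => MvPolynomial.C (P.coords (.inl i))⁻¹ * MvPolynomial.X (.inl i))
      (fun _ => MvPolynomial.C (P.coords (.inr j))⁻¹ * MvPolynomial.X (.inr j)) v)
    (by
      rintro (v | v)
      · exact Ideal.span_mono (by simp [xForm])
          (C_mul_sub_X_mem_span_pairForm Sum.inl P.coords hi v)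
      · exact Ideal.span_mono (by simp [yForm])
          (C_mul_sub_X_mem_span_pairForm Sum.inr P.coords hj v)) c
  rw [aeval_mul_of_mem_bigrading hc, h, map_zero, zero_mul, zero_sub] at key
  exact neg_mem_iff.1 key

/-- The two linear forms of a point form a regular sequence. -/
theorem exists_eq_mul_of_add_eq_zero (P : Point k) {b b' : CoordRing k}
    (h : b * P.xForm + b' * P.yForm = 0) : ∃ e, b = e * P.yForm ∧ b' = -(e * P.xForm) := by
  obtain ⟨j, hj⟩ := P.exists_coords_inr_ne_zero
  -- `τ` is reduction modulo `yForm`, realised as an endomorphism of the domain S. It fixes `xForm`,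
  -- so the relation becomes τ(b) · `xForm` = 0.
  let τ : CoordRing k →ₐ[k] CoordRing k := MvPolynomial.aeval
    (Sum.elim (fun v => MvPolynomial.X (.inl v)) fun v => MvPolynomial.C (P.coords (.inr v)) *
      (MvPolynomial.C (P.coords (.inr j))⁻¹ * MvPolynomial.X (.inr j)))
  have hx : τ P.xForm = P.xForm := by
    simp [τ, xForm, pairForm, MvPolynomial.algebraMap_eq]
  have hy : τ P.yForm = 0 := by
    simp only [τ, yForm, pairForm, map_sub, map_mul, MvPolynomial.aeval_C, MvPolynomial.aeval_X,
      MvPolynomial.algebraMap_eq, Sum.elim_inr]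
    ring
  have hb : τ b = 0 := by
    have := congrArg τ h
    rw [map_add, map_mul, map_mul, hx, hy, mul_zero, add_zero, map_zero] at this
    exact (mul_eq_zero.1 this).resolve_right P.xForm_ne_zero
  have hmem : τ b - b ∈ Ideal.span {P.yForm} := by
    refine aeval_sub_self_mem _ _ ?_ b
    rintro (v | v)
    · simp
    · exact C_mul_sub_X_mem_span_pairForm Sum.inr P.coords hj v
  rw [hb, zero_sub, neg_mem_iff] at hmem
  obtain ⟨e, rfl⟩ := Ideal.mem_span_singleton'.1 hmem
  refine ⟨e, rfl, mul_right_cancel₀ P.yForm_ne_zero ?_⟩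
  linear_combination h

/-- These forms raise the degree of a separator while keeping it nonzero at P. -/
theorem exists_form_eval_ne_zero (P : Point k) (d : ℕ × ℕ) :
    ∃ g ∈ bigrading k d, MvPolynomial.eval P.coords g ≠ 0 := by
  obtain ⟨i, hi⟩ := P.exists_coords_inl_ne_zero
  obtain ⟨j, hj⟩ := P.exists_coords_inr_ne_zero
  refine ⟨MvPolynomial.X (.inl i) ^ d.1 * MvPolynomial.X (.inr j) ^ d.2, ?_, ?_⟩
  · have h := ((MvPolynomial.isWeightedHomogeneous_X k bidegree (.inl i)).pow d.1).mul
      ((MvPolynomial.isWeightedHomogeneous_X k bidegree (.inr j)).pow d.2)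
    have hd : d.1 • bidegree (.inl i) + d.2 • bidegree (.inr j) = d := by
      ext <;> simp [bidegree]
    rw [hd] at h
    exact h
  · simp [hi, hj]

end Point

/-! ### Local rings, components and separators -/

namespace LocalRing

theorem isUnit_mk {P : Point k}
    (c : HomogeneousLocalization.NumDenSameDeg (bigrading k) (nonvanishing P))
    (h : MvPolynomial.eval P.coords (c.num : CoordRing k) ≠ 0) :
    IsUnit (HomogeneousLocalization.mk c : LocalRing P) := by
  refine IsUnit.of_mul_eq_one (HomogeneousLocalization.mk ⟨c.deg, c.den, c.num, h⟩) ?_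
  rw [← HomogeneousLocalization.mk_mul]
  refine HomogeneousLocalization.val_injective _ ?_
  rw [HomogeneousLocalization.val_mk, HomogeneousLocalization.val_one,
    ← Localization.mk_one, Localization.mk_eq_mk_iff, Localization.r_iff_exists]
  refine ⟨1, ?_⟩
  simp only [HomogeneousLocalization.NumDenSameDeg.num_mul,
    HomogeneousLocalization.NumDenSameDeg.den_mul, Submonoid.coe_one]
  ring

end LocalRing

namespace ZeroDimScheme

variable {X : ZeroDimScheme k} {P : Point k}

theorem germ_mem_stalk (hX : (X.stalk P).IsMaximal) {d : ℕ × ℕ} {f g : CoordRing k}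
    (hf : f ∈ bigrading k d) (hg : g ∈ bigrading k d) (hgP : g ∈ nonvanishing P)
    (h : MvPolynomial.eval P.coords f = 0) : germ P d f g hf hg hgP ∈ X.stalk P := by
  by_contra hmem
  obtain ⟨z, i, hi, hz⟩ := hX.exists_inv hmem
  obtain ⟨c, rfl⟩ := HomogeneousLocalization.mk_surjective z
  let q : HomogeneousLocalization.NumDenSameDeg (bigrading k) (nonvanishing P) :=
    ⟨d, ⟨f, hf⟩, ⟨g, hg⟩, hgP⟩
  -- Here i = 1 - z · (f/g). As f(P) = 0, its numerator is nonzero at P, so i would be a unit in a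
  -- proper ideal.
  have hi' : i = HomogeneousLocalization.mk (1 + -(c * q)) := by
    rw [HomogeneousLocalization.mk_add, HomogeneousLocalization.mk_neg,
      HomogeneousLocalization.mk_mul, HomogeneousLocalization.mk_one, ← sub_eq_add_neg]
    exact eq_sub_of_add_eq' hz
  refine hX.ne_top (Ideal.eq_top_of_isUnit_mem _ hi (hi' ▸ LocalRing.isUnit_mk _ ?_))
  have hc : MvPolynomial.eval P.coords (c.den : CoordRing k) ≠ 0 := c.den_mem
  have hg' : MvPolynomial.eval P.coords g ≠ 0 := hgP
  simp [HomogeneousLocalization.NumDenSameDeg.num_add, q, h, hc, hg']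

/-- A generator with f(P) ≠ 0 can serve as its own denominator, which would put the unit f/f in the
stalk. -/
theorem eval_eq_zero_of_mem_component (hP : P ∈ X.support) {f : CoordRing k}
    (hf : f ∈ X.component P) : MvPolynomial.eval P.coords f = 0 := by
  rw [← RingHom.mem_ker]
  refine Ideal.span_le.2 ?_ hf
  rintro f ⟨d, hfd, hf⟩
  by_contra hfP
  exact hP (Ideal.eq_top_of_isUnit_mem _ (hf f hfd hfP) (LocalRing.isUnit_mk _ hfP))

theorem mem_component_of_eval_eq_zero (hmult : X.multiplicity P = 1) {d : ℕ × ℕ}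
    {f : CoordRing k} (hf : f ∈ bigrading k d) (h : MvPolynomial.eval P.coords f = 0) :
    f ∈ X.component P := by
  -- Length one means that the quotient is a simple module.
  have hX : (X.stalk P).IsMaximal := by
    rw [Ideal.isMaximal_def, ← isSimpleModule_iff_isCoatom, ← Module.length_eq_one_iff]
    exact hmult
  exact Ideal.subset_span ⟨d, hf, fun g hg hgP => germ_mem_stalk hX hf hg hgP h⟩

theorem component_eq_top (h : X.stalk P = ⊤) : X.component P = ⊤ := by
  rw [Ideal.eq_top_iff_one]
  exact Ideal.subset_span ⟨0, SetLike.GradedOne.one_mem, fun _ _ _ => h ▸ Submodule.mem_top⟩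

theorem component_congr {X Y : ZeroDimScheme k} {P : Point k} (h : X.stalk P = Y.stalk P) :
    X.component P = Y.component P := by
  rw [component, component, h]

theorem isHomogeneous_component (X : ZeroDimScheme k) (P : Point k) :
    (X.component P).IsHomogeneous (bigrading k) :=
  Ideal.homogeneous_span _ _ fun _ ⟨d, hf, _⟩ => ⟨d, hf⟩

theorem isHomogeneous_ideal (X : ZeroDimScheme k) : X.ideal.IsHomogeneous (bigrading k) :=
  Ideal.IsHomogeneous.iInf X.isHomogeneous_component

theorem stalk_erase_self : (X.erase P).stalk P = ⊤ := by
  classical exact Function.update_self _ _ _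

theorem stalk_erase_of_ne {P' : Point k} (h : P' ≠ P) : (X.erase P).stalk P' = X.stalk P' := by
  classical exact Function.update_of_ne h _ _

theorem mem_ideal_erase {f : CoordRing k} :
    f ∈ (X.erase P).ideal ↔ ∀ P' ∈ X.support, P' ≠ P → f ∈ X.component P' := by
  rw [ideal, Submodule.mem_iInf]
  constructor
  · intro h P' _ hne
    rw [← component_congr (X := X.erase P) (stalk_erase_of_ne hne)]
    exact h P'
  · intro h P'
    by_cases hne : P' = P
    · subst hne
      rw [component_eq_top stalk_erase_self]
      trivial
    · rw [component_congr (Y := X) (stalk_erase_of_ne hne)]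
      by_cases hP' : X.stalk P' = ⊤
      · rw [component_eq_top hP']
        trivial
      · exact h P' hP' hne

theorem mem_ideal_iff {f : CoordRing k} :
    f ∈ X.ideal ↔ f ∈ (X.erase P).ideal ∧ f ∈ X.component P := by
  rw [mem_ideal_erase, ideal, Submodule.mem_iInf]
  refine ⟨fun h => ⟨fun P' _ _ => h P', h P⟩, fun ⟨h, hP⟩ P' => ?_⟩
  by_cases hne : P' = P
  · exact hne ▸ hP
  by_cases hP' : X.stalk P' = ⊤
  · rw [component_eq_top hP']
    trivial
  · exact h P' hP' hne

theorem IsSeparator.mem_ideal_erase {d : ℕ × ℕ} {f : CoordRing k} (hf : X.IsSeparator P d f) :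
    f ∈ (X.erase P).ideal :=
  ZeroDimScheme.mem_ideal_erase.2 hf.2.2

/-- A unique minimal separating degree is the least separating degree. -/
theorem IsUniqueMinimalSeparatingDegree.le {d e : ℕ × ℕ}
    (hd : X.IsUniqueMinimalSeparatingDegree P d) {g : CoordRing k} (hg : X.IsSeparator P e g) :
    d ≤ e := by
  induction e using WellFoundedLT.induction generalizing g with
  | ind e ih =>
    -- Descent below `e` ends at a minimal separating degree, which can only be `d`.
    by_cases h : ∃ e', e' < e ∧ ∃ g', X.IsSeparator P e' g'
    · obtain ⟨e', he', g', hg'⟩ := h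
      exact (ih e' he' hg').trans he'.le
    · exact (hd.2 e ⟨⟨g, hg⟩, h⟩).ge

/-- Removing a reduced point with a unique minimal separating degree adds a separator of that
degree to the ideal. -/
theorem ideal_erase_eq_sup (hmult : X.multiplicity P = 1) {d : ℕ × ℕ}
    (hd : X.IsUniqueMinimalSeparatingDegree P d) {f : CoordRing k} (hf : X.IsSeparator P d f) :
    (X.erase P).ideal = X.ideal ⊔ Ideal.span {f} := by
  refine le_antisymm ?_ (sup_le (fun g hg => (mem_ideal_iff.1 hg).1) ?_)
  · intro g hg
    classical
    rw [← DirectSum.sum_support_decompose (bigrading k) g]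
    refine sum_mem fun e _ => ?_
    have hgJ := (X.erase P).isHomogeneous_ideal e hg
    have hge := (DirectSum.decompose (bigrading k) g e).2
    generalize (DirectSum.decompose (bigrading k) g e : CoordRing k) = g' at hgJ hge
    by_cases hgP : MvPolynomial.eval P.coords g' = 0
    · exact Ideal.mem_sup_left
        (mem_ideal_iff.2 ⟨hgJ, mem_component_of_eval_eq_zero hmult hge hgP⟩)
    · have hle : d ≤ e := hd.le ⟨hge, hgP, mem_ideal_erase.1 hgJ⟩
      -- The subtraction is not truncated because d ≤ e. The scalar `c` below makes the values of
      -- `g'` and c h f at P agree.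
      obtain ⟨h, hh, hhP⟩ := P.exists_form_eval_ne_zero (e - d)
      have hhf : h * f ∈ bigrading k e := by
        rw [← tsub_add_cancel_of_le hle]
        exact SetLike.mul_mem_graded hh hf.1
      let c := MvPolynomial.eval P.coords g' / MvPolynomial.eval P.coords (h * f)
      have hmem : g' - c • (h * f) ∈ X.ideal := by
        refine mem_ideal_iff.2 ⟨sub_mem hgJ ?_, mem_component_of_eval_eq_zero hmult
          (sub_mem hge (Submodule.smul_mem _ c hhf)) ?_⟩
        · exact Submodule.smul_of_tower_mem _ c (Ideal.mul_mem_left _ _ hf.mem_ideal_erase)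
        · rw [map_sub, MvPolynomial.smul_eval, div_mul_cancel₀, sub_self]
          rw [map_mul]
          exact mul_ne_zero hhP hf.2.1
      rw [← sub_add_cancel g' (c • (h * f))]
      exact add_mem (Ideal.mem_sup_left hmem) (Ideal.mem_sup_right (Submodule.smul_of_tower_mem _ c
        (Ideal.mul_mem_left _ _ (Ideal.mem_span_singleton_self f))))
  · rw [Ideal.span_singleton_le_iff_mem]
    exact hf.mem_ideal_erase

/-- The colon ideal of a separator of a reduced point is the ideal of the point. -/
theorem IsSeparator.mem_span_of_mul_mem_ideal (hP : P ∈ X.support) {d : ℕ × ℕ}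
    {f : CoordRing k} (hf : X.IsSeparator P d f) {c : CoordRing k} (hc : c * f ∈ X.ideal) :
    c ∈ Ideal.span {P.xForm, P.yForm} := by
  classical
  rw [← DirectSum.sum_support_decompose (bigrading k) c]
  refine sum_mem fun e _ => P.mem_span_of_eval_eq_zero (SetLike.coe_mem _) ?_
  have h := eval_eq_zero_of_mem_component hP
    (mem_ideal_iff.1 (X.isHomogeneous_ideal (e + d) hc)).2
  -- Since f has degree d, the degree e + d part of c f is the degree e part of c times f. Its
  -- vanishing at P passes to the first factor.
  rw [DirectSum.coe_decompose_mul_add_of_right_mem _ hf.1, map_mul] at h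
  exact (mul_eq_zero.1 h).resolve_right hf.2.1

theorem IsSeparator.mul_mem_ideal (hmult : X.multiplicity P = 1) {d e : ℕ × ℕ}
    {f l : CoordRing k} (hf : X.IsSeparator P d f) (hl : l ∈ bigrading k e)
    (h : MvPolynomial.eval P.coords l = 0) : l * f ∈ X.ideal :=
  mem_ideal_iff.2 ⟨Ideal.mul_mem_left _ _ hf.mem_ideal_erase,
    mem_component_of_eval_eq_zero hmult (SetLike.mul_mem_graded hl hf.1)
      (by rw [map_mul, h, zero_mul])⟩

end ZeroDimScheme

end

end BiProj

/-! ### The resolution of Z -/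

theorem lemmaL {k : Type*} [Field k] [IsAlgClosed k]
    (Y : BiProj.ZeroDimScheme k) (m n t : ℕ)
    (a₁ : Fin m → ℕ × ℕ) (a₂ : Fin n → ℕ × ℕ) (a₃ : Fin t → ℕ × ℕ)
    (res : BiProj.MinimalFreeResolution Y.ideal a₁ a₂ a₃)
    (P : BiProj.Point k) (hP : P ∈ Y.support) (hmult : Y.multiplicity P = 1)
    (r s : ℕ) (hsep : Y.IsUniqueMinimalSeparatingDegree P (r, s))
    (hgen : ∀ i, ¬ (r, s) < a₁ i)
    (hsyz : ∀ i, (r + 1, s + 1) ≠ a₂ i) :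
    Nonempty (BiProj.MinimalFreeResolution (Y.erase P).ideal
      (Sum.elim a₁ ![(r, s)])
      (Sum.elim a₂ ![(r + 1, s), (r, s + 1)])
      (Sum.elim a₃ ![(r + 1, s + 1)])) := by
  obtain ⟨f, hf⟩ := hsep.1.1
  rw [BiProj.ZeroDimScheme.ideal_erase_eq_sup hmult hsep hf]
  refine res.sup_span_singleton hf.1 P.xForm_mem_bigrading P.yForm_mem_bigrading
    (hf.mul_mem_ideal hmult P.xForm_mem_bigrading P.eval_xForm)
    (hf.mul_mem_ideal hmult P.yForm_mem_bigrading P.eval_yForm)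
    (fun c hc => ?_) (fun _ _ => P.exists_eq_mul_of_add_eq_zero) P.yForm_ne_zero
    (fun i h => hgen i ?_) (fun i h => hgen i ?_) fun i h => hsyz i h.symm
  · obtain ⟨b, b', h⟩ := Ideal.mem_span_pair.1 (hf.mem_span_of_mul_mem_ideal hP hc)
    exact ⟨b, b', h.symm⟩
  -- Condition 2 enters only through the degrees (r + 1, s) and (r, s + 1), both strictly above (r,
  -- s).
  · rw [h]
    exact Prod.mk_lt_mk.2 (.inl ⟨Nat.lt_succ_self r, le_rfl⟩)
  · rw [h]
    exact Prod.mk_lt_mk.2 (.inr ⟨le_rfl, Nat.lt_succ_self s⟩)
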